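/- Let $T>0$, $n,k\ge 1$, let $\bar A_0,\dots,\bar A_k$ be constant real $n\times n$ matrices with $\det \bar A_k=0$, and let $\bar K(u)$ be an $n\times n$ matrix whose entries are real analytic functions on $[0,T]$. Consider the homogeneous system $$(\bar\Lambda_k+\bar{\mathcal V})v:=\sum_{i=0}^k \bar A_i v^{(i)}(t)+\int_0^t \bar K(t-s)v(s)\,ds=0,\qquad t\in[0,T]. \tag{1}$$ Its solutions are the functions $v\in C^k([0,T];\mathbb R^n)$ satisfying it on $[0,T]$. The solution space is called finite-dimensional if, for some $d\ge 0$, there is an $n\times d$ matrix function $X_d\in C^k([0,T])$ such that the solutions are exactly the functions $X_d(t)c$, $c\in\mathbb R^d$. An operator $\Lambda_N+\mathcal V$ of this form, of order $N$, is said to have index $l$ if $l$ is the smallest integer $\geq 0$ for which there are constant $n\times n$ matrices $L_0,\dots,L_l$, continuous matrix functions $\tilde A_0,\dots,\tilde A_N$ on $[0,T]$ with $\det\tilde A_N(t)\ne0$ on $[0,T]$, and a continuous kernel $\tilde K$ such that $$\sum_{m=0}^l L_m\Big(\frac{d}{dt}\Big)^m(\Lambda_N+\mathcal V)z=\sum_{i=0}^N\tilde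 A_i(t) z^{(i)}(t)+\int_0^t\tilde K(t-s)z(s)\,ds\quad\text{on }[0,T]\text{ for all } z\in C^{l+N}([0,T];\mathbb R^n).$$ For $j\ge 0$ write $$\Big(\frac{d}{dt}\Big)^j(\bar\Lambda_k+\bar{\mathcal V})v=\sum_{i=0}^{j+k}\check A_i v^{(i)}(t)+\int_0^t \bar K^{(j)}(t-s)v(s)\,ds,$$ that is, $\check A_{j+i}=\bar A_i$ for $0\le i\le k$ and $\check A_i=\bar K^{(j-1-i)}(0)$ for $0\le i<j$, and let $\check\Lambda_{j+k}=\sum_{i=0}^{j+k}\check A_i (d/dt)^i$ be the purely differential part, regarded as an operator of order $j+k$. **Theorem.** If for some $j\ge0$ the operator $\check\Lambda_{j+k}$ has an index $l_j$ and $l_j\le j+k$, then the solution space of (1) is finite-dimensional. -/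

import Mathlib

open Set
open scoped Matrix

noncomputable section

/-- The operator `v ↦ ∑_{i ≤ k} A_i(t) v^{(i)}(t) + ∫_0^t K(t - s) v(s) ds` on `[0, T]`.
Derivatives are taken within `[0, T]` (one-sided at the end points). -/
def integroDiffOp {n : ℕ} (T : ℝ) (k : ℕ) (A : ℕ → ℝ → Matrix (Fin n) (Fin n) ℝ)
    (K : ℝ → Matrix (Fin n) (Fin n) ℝ) (v : ℝ → Fin n → ℝ) : ℝ → Fin n → ℝ :=
  fun t => (∑ i ∈ Finset.range (k + 1), A i t *ᵥ iteratedDerivWithin i v (Icc 0 T) t)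
    + ∫ s in (0 : ℝ)..t, K (t - s) *ᵥ v s

/-- `v` is a `C^k` solution on `[0, T]` of the homogeneous system with constant
coefficient matrices `A_0, …, A_k` and convolution kernel `K`. -/
def IsHomSolution {n : ℕ} (T : ℝ) (k : ℕ) (A : ℕ → Matrix (Fin n) (Fin n) ℝ)
    (K : ℝ → Matrix (Fin n) (Fin n) ℝ) (v : ℝ → Fin n → ℝ) : Prop :=
  ContDiffOn ℝ k v (Icc 0 T) ∧
    ∀ t ∈ Icc (0 : ℝ) T, integroDiffOp T k (fun i _ => A i) K v t = 0

/-- The solution space of the homogeneous system is finite-dimensional: for some `d` there is an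
`n × d` matrix function `X` of class `C^k` on `[0, T]` such that the solutions are
exactly the functions `X(t) c`, `c ∈ ℝ^d`, on `[0, T]`. -/
def FiniteDimSolutionSpace {n : ℕ} (T : ℝ) (k : ℕ) (A : ℕ → Matrix (Fin n) (Fin n) ℝ)
    (K : ℝ → Matrix (Fin n) (Fin n) ℝ) : Prop :=
  ∃ (d : ℕ) (X : ℝ → Matrix (Fin n) (Fin d) ℝ),
    (∀ a b, ContDiffOn ℝ k (fun t => X t a b) (Icc 0 T)) ∧
    ∀ v : ℝ → Fin n → ℝ, IsHomSolution T k A K v ↔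
      ∃ c : Fin d → ℝ, ∀ t ∈ Icc (0 : ℝ) T, v t = X t *ᵥ c

/-- `Ω_l = ∑_{m ≤ l} L_m (d/dt)^m` is a left regularizing operator of the operator
of order `k` with constant coefficients `A_0, …, A_k` and kernel `K`: on all
`z` of class `C^{l+k}` the composition is again an integro-differential operator of order `k`,
with continuous coefficients, whose leading matrix is invertible. -/
def IsLeftRegularizing {n : ℕ} (T : ℝ) (k : ℕ) (A : ℕ → Matrix (Fin n) (Fin n) ℝ)
    (K : ℝ → Matrix (Fin n) (Fin n) ℝ) (l : ℕ) (L : ℕ → Matrix (Fin n) (Fin n) ℝ) : Prop :=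
  ∃ (A' : ℕ → ℝ → Matrix (Fin n) (Fin n) ℝ) (K' : ℝ → Matrix (Fin n) (Fin n) ℝ),
    (∀ i, ContinuousOn (A' i) (Icc 0 T)) ∧ ContinuousOn K' (Icc 0 T) ∧
    (∀ t ∈ Icc (0 : ℝ) T, (A' k t).det ≠ 0) ∧
    ∀ z : ℝ → Fin n → ℝ, ContDiffOn ℝ ((l + k : ℕ) : WithTop ℕ∞) z (Icc 0 T) →
      ∀ t ∈ Icc (0 : ℝ) T,
        (∑ m ∈ Finset.range (l + 1),
          L m *ᵥ iteratedDerivWithin m (integroDiffOp T k (fun i _ => A i) K z) (Icc 0 T) t)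
        = integroDiffOp T k A' K' z t

/-- The operator of order `k` with coefficients `A` and kernel `K` has index `l`: there is a left
regularizing operator of order `l`, and `l` is the smallest such number. -/
def HasIndex {n : ℕ} (T : ℝ) (k : ℕ) (A : ℕ → Matrix (Fin n) (Fin n) ℝ)
    (K : ℝ → Matrix (Fin n) (Fin n) ℝ) (l : ℕ) : Prop :=
  IsLeast {m : ℕ | ∃ L : ℕ → Matrix (Fin n) (Fin n) ℝ, IsLeftRegularizing T k A K m L} l

/-- The (entrywise, one-sided) derivative `K^{(m)}(0)`. -/
def kernelDerivAtZero {n : ℕ} (T : ℝ) (K : ℝ → Matrix (Fin n) (Fin n) ℝ) (m : ℕ) :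
    Matrix (Fin n) (Fin n) ℝ :=
  Matrix.of fun a b => iteratedDerivWithin m (fun u => K u a b) (Icc 0 T) 0

/-- The coefficients of the purely differential part of the `j` times differentiated operator.
Since `(d/dt)^j ∫_0^t K(t-s) v(s) ds = ∑_{i<j} K^{(j-1-i)}(0) v^{(i)}(t) + ∫_0^t K^{(j)}(t-s) v(s) ds`,
the coefficient of `v^{(i)}` is `K^{(j-1-i)}(0)` for `i < j` and `A_{i-j}` for `j ≤ i ≤ j + k`. -/
def prolongedCoeff {n : ℕ} (T : ℝ) (A : ℕ → Matrix (Fin n) (Fin n) ℝ)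
    (K : ℝ → Matrix (Fin n) (Fin n) ℝ) (j : ℕ) : ℕ → Matrix (Fin n) (Fin n) ℝ :=
  fun i => if i < j then kernelDerivAtZero T K (j - 1 - i) else A (i - j)

end

/-! A solution is determined by its jet `v^{(i)}(0)`, `i < k`. The jet map is therefore injective
into a space of dimension `kn`, and a basis of the solution space supplies the columns of `X`. It
remains to show that a solution `v` with zero jet vanishes (`IsHomSolution.eq_zero_of_jet_eq_zero`).

Instead of differentiating the equation, which `v` may not be smooth enough to allow, one integrates
it. Let `J` be integration from `0`. With zero jet, `J^i v^{(i)} = v`, so applying `J^k` gives an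
equation in `v` alone. Expanding the convolution in powers of `J` (`volterraConv_taylor`) turns it,
with `N = j + k`, into `∑ P_r J^{N-r} v + J^N C v = 0`, where the `P_r` are the prolonged
coefficients and `C` is convolution with `K^{(j)}`.

A regularizing operator provides a matrix polynomial identity `L P = Q` with `deg Q ≤ N` and `Q_N`
invertible (`IsLeftRegularizing.exists_coeff`). Read in powers of `J`, it says that `∑ L_m J^{l-m}`
maps the left side to `J^l (Q_N v + B v)`, where `B` is of Volterra type (`sum_mul_reversed_eq`); `l
≤ N` lets `J^l` be factored out of the remainder. Since `J` is injective, `Q_N v + B v = 0`, a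
Volterra equation of the second kind, and Grönwall gives `v = 0`. -/

/-! ### Integration and convolution as endomorphisms of `C([0, T], E)`. -/

section VolterraOperators

open MeasureTheory

variable {E : Type*} [NormedAddCommGroup E] [NormedSpace ℝ E]

/-- Fubini's theorem on the triangle `0 ≤ r ≤ s ≤ t`. -/
theorem intervalIntegral_triangle_swap {F : ℝ → ℝ → E}
    (hF : Continuous (Function.uncurry F)) {t : ℝ} (ht : 0 ≤ t) :
    ∫ s in (0 : ℝ)..t, ∫ r in (0 : ℝ)..s, F s r = ∫ r in (0 : ℝ)..t, ∫ s in r..t, F s r := by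
  -- Extension by zero from the triangle to the square, where Fubini for rectangles applies.
  set G : ℝ → ℝ → E := fun s r => {p : ℝ × ℝ | p.2 ≤ p.1}.indicator (Function.uncurry F) (s, r)
    with hG
  have hmeas : MeasurableSet {p : ℝ × ℝ | p.2 ≤ p.1} :=
    measurableSet_le measurable_snd measurable_fst
  have hint : IntegrableOn (Function.uncurry G) (uIoc 0 t ×ˢ uIoc 0 t) := by
    have h1 : IntegrableOn (Function.uncurry F) (uIoc 0 t ×ˢ uIoc 0 t) := by
      refine (hF.continuousOn.integrableOn_compact
        (isCompact_uIcc.prod isCompact_uIcc)).mono_set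
        (Set.prod_mono (s₂ := uIcc 0 t) (t₂ := uIcc 0 t) uIoc_subset_uIcc uIoc_subset_uIcc)
    exact h1.indicator hmeas
  have h := intervalIntegral_intervalIntegral_swap (a := 0) (b := t) (c := 0) (d := t) hint
  have hl : ∀ s ∈ Icc 0 t, ∫ r in (0 : ℝ)..t, G s r = ∫ r in (0 : ℝ)..s, F s r := by
    intro s hs
    have : ∀ r, G s r = (Iic s).indicator (F s) r := by
      intro r; simp only [hG, indicator]; rfl
    simp_rw [this]
    rw [intervalIntegral.integral_of_le ht, intervalIntegral.integral_of_le hs.1,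
      setIntegral_indicator measurableSet_Iic]
    congr 2
    ext x; simp only [mem_inter_iff, mem_Ioc, mem_Iic]
    exact ⟨fun h => ⟨h.1.1, h.2⟩, fun h => ⟨⟨h.1, h.2.trans hs.2⟩, h.2⟩⟩
  have hr : ∀ r ∈ Icc 0 t, ∫ s in (0 : ℝ)..t, G s r = ∫ s in r..t, F s r := by
    intro r hr
    have : ∀ s, G s r = (Ici r).indicator (fun s => F s r) s := by
      intro r; simp only [hG, indicator]; rfl
    simp_rw [this]
    -- Closed intervals are used because for `r = 0` the half-open `Ioc 0 t` misses the end point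
    -- `r`.
    rw [intervalIntegral.integral_of_le ht, intervalIntegral.integral_of_le hr.2,
      setIntegral_indicator measurableSet_Ici,
      ← setIntegral_congr_set (Ioc_ae_eq_Icc.symm.inter (ae_eq_refl (Ici r))),
      ← integral_Icc_eq_integral_Ioc]
    congr 2
    ext x; simp only [mem_inter_iff, mem_Icc, mem_Ici]
    exact ⟨fun h => ⟨h.2, h.1.2⟩, fun h => ⟨⟨hr.1.trans h.1, h.2⟩, h.1⟩⟩
  rw [intervalIntegral.integral_congr (g := fun s => ∫ r in (0 : ℝ)..s, F s r)
    (fun s hs => hl s (by rwa [uIcc_of_le ht] at hs)),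
    intervalIntegral.integral_congr (g := fun r => ∫ s in r..t, F s r)
    (fun s hs => hr s (by rwa [uIcc_of_le ht] at hs))] at h
  exact h

/-- The Volterra integral `f ↦ ∫_0^t f` on `C([0, T], E)`. -/
noncomputable def volterraInt {T : ℝ} (hT : 0 ≤ T) : Module.End ℝ C(Icc (0 : ℝ) T, E) where
  toFun f := ⟨fun t => ∫ s in (0 : ℝ)..t, f.IccExtend hT s,
    (intervalIntegral.continuous_primitive
      (fun a b => (f.IccExtend hT).continuous.intervalIntegrable a b) 0).comp
      continuous_subtype_val⟩
  map_add' f g := by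
    ext t
    exact intervalIntegral.integral_add ((f.IccExtend hT).continuous.intervalIntegrable _ _)
      ((g.IccExtend hT).continuous.intervalIntegrable _ _)
  map_smul' c f := by
    ext t
    exact intervalIntegral.integral_smul c _

/-- The convolution `f ↦ ∫_0^t κ(t - s) f(s) ds` on `C([0, T], E)`. -/
noncomputable def volterraConv {T : ℝ} (hT : 0 ≤ T) (κ : C(Icc (0 : ℝ) T, E →L[ℝ] E)) :
    Module.End ℝ C(Icc (0 : ℝ) T, E) where
  toFun f := ⟨fun t => ∫ s in (0 : ℝ)..t, κ.IccExtend hT (t - s) (f.IccExtend hT s), by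
    have h : Continuous fun t : ℝ => ∫ s in (0 : ℝ)..t,
        κ.IccExtend hT (t - s) (f.IccExtend hT s) :=
      intervalIntegral.continuous_parametric_intervalIntegral_of_continuous
        (by fun_prop) continuous_id
    exact h.comp continuous_subtype_val⟩
  map_add' f g := by
    ext t
    have h : ∀ f : C(Icc (0 : ℝ) T, E), IntervalIntegrable
        (fun s => κ.IccExtend hT (t - s) (f.IccExtend hT s)) volume 0 t := fun f =>
      Continuous.intervalIntegrable (by fun_prop) _ _
    refine Eq.trans ?_ (intervalIntegral.integral_add (h f) (h g))
    refine intervalIntegral.integral_congr fun s _ => ?_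
    exact map_add (κ.IccExtend hT (t - s)) _ _
  map_smul' c f := by
    ext t
    refine Eq.trans ?_ (intervalIntegral.integral_smul c _)
    refine intervalIntegral.integral_congr fun s _ => ?_
    exact map_smul (κ.IccExtend hT (t - s)) _ _

/-- Pointwise application of an operator, as a ring homomorphism. -/
def pointwiseOp (E : Type*) [NormedAddCommGroup E] [NormedSpace ℝ E] (T : ℝ) :
    (E →L[ℝ] E) →+* Module.End ℝ C(Icc (0 : ℝ) T, E) where
  toFun A :=
    { toFun := fun f => ⟨fun t => A (f t), by fun_prop⟩
      map_add' := fun f g => by ext t; exact map_add A _ _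
      map_smul' := fun c f => by ext t; exact map_smul A _ _ }
  map_one' := rfl
  map_mul' _ _ := rfl
  map_zero' := rfl
  map_add' _ _ := rfl

variable {T : ℝ} (hT : 0 ≤ T)

theorem IccExtend_coe_of_mem {F : Type*} [TopologicalSpace F] (f : C(Icc (0 : ℝ) T, F)) {s : ℝ}
    (hs : s ∈ Icc 0 T) : f.IccExtend hT s = f ⟨s, hs⟩ :=
  Set.IccExtend_of_mem hT f hs

theorem volterraInt_apply (f : C(Icc (0 : ℝ) T, E)) (t : Icc (0 : ℝ) T) :
    volterraInt hT f t = ∫ s in (0 : ℝ)..t, f.IccExtend hT s := rfl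

theorem volterraConv_apply (κ : C(Icc (0 : ℝ) T, E →L[ℝ] E)) (f : C(Icc (0 : ℝ) T, E))
    (t : Icc (0 : ℝ) T) :
    volterraConv hT κ f t = ∫ s in (0 : ℝ)..t, κ.IccExtend hT (t - s) (f.IccExtend hT s) := rfl

theorem pointwiseOp_apply (A : E →L[ℝ] E) (f : C(Icc (0 : ℝ) T, E)) (t : Icc (0 : ℝ) T) :
    pointwiseOp E T A f t = A (f t) := rfl

/-- Constant operators pass through the integral, so `J` behaves like a central indeterminate over
matrix coefficients. This is what carries matrix polynomial identities over to operators. -/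
theorem commute_pointwiseOp_volterraInt [CompleteSpace E] (A : E →L[ℝ] E) :
    Commute (pointwiseOp E T A) (volterraInt hT) := by
  refine LinearMap.ext fun f => ContinuousMap.ext fun t => ?_
  exact (A.intervalIntegral_comp_comm
    ((f.IccExtend hT).continuous.intervalIntegrable _ _)).symm

/-- Differentiation recovers `f`. This needs `0 < T`: over a single point the integral is zero. -/
theorem volterraInt_injective [CompleteSpace E] (hT₀ : 0 < T) :
    Function.Injective (volterraInt hT₀.le (E := E)) := by
  rw [injective_iff_map_eq_zero]
  intro f hf
  ext t
  have h1 : HasDerivWithinAt (fun u => ∫ s in (0 : ℝ)..u, f.IccExtend hT₀.le s)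
      (f.IccExtend hT₀.le t) (Icc 0 T) t :=
    (((f.IccExtend hT₀.le).continuous.integral_hasStrictDerivAt 0 t).hasDerivAt).hasDerivWithinAt
  have h2 : HasDerivWithinAt (fun u => ∫ s in (0 : ℝ)..u, f.IccExtend hT₀.le s)
      (0 : E) (Icc 0 T) t :=
    (hasDerivWithinAt_const (t : ℝ) (Icc 0 T) (0 : E)).congr
      (fun u hu => DFunLike.congr_fun hf ⟨u, hu⟩)
      (DFunLike.congr_fun hf t)
  have h3 := (uniqueDiffOn_Icc hT₀ t t.2).eq_deriv _ h1 h2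
  rwa [IccExtend_coe_of_mem hT₀.le f t.2] at h3

/-- Expansion of a convolution whose kernel is `κ₀ + ∫_0^t κ'`. -/
theorem volterraConv_eq [CompleteSpace E] (κ κ' : C(Icc (0 : ℝ) T, E →L[ℝ] E)) (κ₀ : E →L[ℝ] E)
    (h : ∀ t, κ t = κ₀ + volterraInt hT κ' t) :
    volterraConv hT κ =
      pointwiseOp E T κ₀ * volterraInt hT + volterraInt hT * volterraConv hT κ' := by
  refine LinearMap.ext fun f => ContinuousMap.ext fun t => ?_
  obtain ⟨t, ht⟩ := t
  change ∫ s in (0 : ℝ)..t, κ.IccExtend hT (t - s) (f.IccExtend hT s) =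
    κ₀ (∫ s in (0 : ℝ)..t, f.IccExtend hT s) +
      ∫ r in (0 : ℝ)..t, (volterraConv hT κ' f).IccExtend hT r
  have e1 : ∫ r in (0 : ℝ)..t, (volterraConv hT κ' f).IccExtend hT r =
      ∫ r in (0 : ℝ)..t, ∫ s in (0 : ℝ)..r, κ'.IccExtend hT (r - s) (f.IccExtend hT s) := by
    refine intervalIntegral.integral_congr fun r hr => ?_
    rw [uIcc_of_le ht.1] at hr
    have hr' : r ∈ Icc 0 T := ⟨hr.1, hr.2.trans ht.2⟩
    simp only [IccExtend_coe_of_mem hT _ hr', volterraConv_apply]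
  rw [e1, intervalIntegral_triangle_swap (by unfold Function.uncurry; fun_prop) ht.1,
    ← κ₀.intervalIntegral_comp_comm ((f.IccExtend hT).continuous.intervalIntegrable _ _)]
  -- After the swap the inner integral is a primitive of `κ'` at `t - s`, that is, `κ (t - s) - κ₀`.
  have e2 : ∀ s, ∫ r in s..t, κ'.IccExtend hT (r - s) (f.IccExtend hT s) =
      (∫ u in (0 : ℝ)..(t - s), κ'.IccExtend hT u) (f.IccExtend hT s) := by
    intro s
    rw [intervalIntegral.integral_comp_sub_right
      (fun u => κ'.IccExtend hT u (f.IccExtend hT s)) s, sub_self]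
    exact ((ContinuousLinearMap.apply ℝ E (f.IccExtend hT s)).intervalIntegral_comp_comm
      ((κ'.IccExtend hT).continuous.intervalIntegrable _ _))
  simp_rw [e2]
  rw [← intervalIntegral.integral_add]
  · refine intervalIntegral.integral_congr fun s hs => ?_
    rw [uIcc_of_le ht.1] at hs
    have hs' : t - s ∈ Icc 0 T := ⟨by linarith [hs.2], by linarith [hs.1, ht.2]⟩
    simp only [IccExtend_coe_of_mem hT _ hs', h, volterraInt_apply]
    rfl
  · exact Continuous.intervalIntegrable (by fun_prop) _ _
  · have : Continuous fun s : ℝ => ∫ u in (0 : ℝ)..(t - s), κ'.IccExtend hT u :=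
      (intervalIntegral.continuous_primitive
        (fun a b => (κ'.IccExtend hT).continuous.intervalIntegrable a b) 0).comp (by fun_prop)
    exact Continuous.intervalIntegrable (by fun_prop) _ _

/-! ### Volterra bounds and uniqueness. -/

/-- An operator on `C([0, T], E)` dominated by a multiple of the integral of the norm. -/
def IsVolterraBounded (B : Module.End ℝ C(Icc (0 : ℝ) T, E)) : Prop :=
  ∃ M : ℝ, 0 ≤ M ∧ ∀ f t, ‖B f t‖ ≤ M * ∫ s in (0 : ℝ)..t, ‖f.IccExtend hT s‖

variable {hT}

theorem IsVolterraBounded.add {B B' : Module.End ℝ C(Icc (0 : ℝ) T, E)}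
    (hB : IsVolterraBounded hT B) (hB' : IsVolterraBounded hT B') :
    IsVolterraBounded hT (B + B') := by
  obtain ⟨M, hM, h⟩ := hB
  obtain ⟨M', hM', h'⟩ := hB'
  refine ⟨M + M', by positivity, fun f t => ?_⟩
  rw [add_mul]
  exact (norm_add_le _ _).trans (add_le_add (h f t) (h' f t))

theorem IsVolterraBounded.sum {ι : Type*} (s : Finset ι)
    {B : ι → Module.End ℝ C(Icc (0 : ℝ) T, E)} (hB : ∀ i ∈ s, IsVolterraBounded hT (B i)) :
    IsVolterraBounded hT (∑ i ∈ s, B i) := by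
  classical
  induction s using Finset.induction_on with
  | empty => exact ⟨0, le_rfl, fun f t => by simp⟩
  | insert i s hi ih =>
    rw [Finset.sum_insert hi]
    exact (hB i (by simp)).add (ih fun j hj => hB j (by simp [hj]))

theorem IsVolterraBounded.pointwiseOp_mul {B : Module.End ℝ C(Icc (0 : ℝ) T, E)}
    (hB : IsVolterraBounded hT B) (A : E →L[ℝ] E) :
    IsVolterraBounded hT (pointwiseOp E T A * B) := by
  obtain ⟨M, hM, h⟩ := hB
  refine ⟨‖A‖ * M, by positivity, fun f t => ?_⟩
  rw [mul_assoc]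
  exact (A.le_opNorm _).trans (mul_le_mul_of_nonneg_left (h f t) (norm_nonneg A))

variable (hT) in
theorem isVolterraBounded_volterraInt : IsVolterraBounded hT (volterraInt hT (E := E)) :=
  ⟨1, zero_le_one, fun f t => by
    rw [one_mul]
    exact intervalIntegral.norm_integral_le_integral_norm t.2.1⟩

variable (hT) in
theorem isVolterraBounded_volterraConv (κ : C(Icc (0 : ℝ) T, E →L[ℝ] E)) :
    IsVolterraBounded hT (volterraConv hT κ) := by
  refine ⟨‖κ‖, norm_nonneg κ, fun f t => ?_⟩
  rw [volterraConv_apply, ← intervalIntegral.integral_const_mul]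
  refine (intervalIntegral.norm_integral_le_integral_norm t.2.1).trans ?_
  refine intervalIntegral.integral_mono_on t.2.1
    (Continuous.intervalIntegrable (by fun_prop) _ _)
    (Continuous.intervalIntegrable (by fun_prop) _ _) fun s _ => ?_
  exact (ContinuousLinearMap.le_opNorm _ _).trans
    (mul_le_mul_of_nonneg_right (κ.norm_coe_le_norm _) (norm_nonneg _))

/-- The integral of `‖f‖` is nondecreasing in its upper limit, so its value at `t` bounds the
integrand and one more integration costs a factor `T`. -/
theorem IsVolterraBounded.volterraInt_mul {B : Module.End ℝ C(Icc (0 : ℝ) T, E)}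
    (hB : IsVolterraBounded hT B) : IsVolterraBounded hT (volterraInt hT * B) := by
  obtain ⟨M, hM, h⟩ := hB
  refine ⟨T * M, by positivity, fun f t => ?_⟩
  have hΦ : 0 ≤ ∫ s in (0 : ℝ)..t, ‖f.IccExtend hT s‖ :=
    intervalIntegral.integral_nonneg t.2.1 fun _ _ => norm_nonneg _
  refine (intervalIntegral.norm_integral_le_of_norm_le_const
    (C := M * ∫ s in (0 : ℝ)..t, ‖f.IccExtend hT s‖) fun s hs => ?_).trans ?_
  · rw [uIoc_of_le t.2.1] at hs
    rw [IccExtend_coe_of_mem hT (B f) ⟨hs.1.le, hs.2.trans t.2.2⟩]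
    refine (h f _).trans (mul_le_mul_of_nonneg_left ?_ hM)
    exact intervalIntegral.integral_mono_interval le_rfl hs.1.le hs.2
      (Filter.Eventually.of_forall fun _ => norm_nonneg _)
      (Continuous.intervalIntegrable (by fun_prop) _ _)
  · rw [sub_zero, abs_of_nonneg t.2.1, mul_comm, mul_assoc]
    exact mul_le_mul_of_nonneg_right t.2.2 (by positivity)

theorem IsVolterraBounded.volterraInt_pow_mul {B : Module.End ℝ C(Icc (0 : ℝ) T, E)}
    (hB : IsVolterraBounded hT B) (p : ℕ) : IsVolterraBounded hT (volterraInt hT ^ p * B) := by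
  induction p with
  | zero => simpa using hB
  | succ p ih =>
    rw [pow_succ', mul_assoc]
    exact ih.volterraInt_mul

/-- Uniqueness for Volterra equations of the second kind. -/
theorem IsVolterraBounded.eq_zero {B : Module.End ℝ C(Icc (0 : ℝ) T, E)}
    (hB : IsVolterraBounded hT B) {f : C(Icc (0 : ℝ) T, E)} (hf : f + B f = 0) : f = 0 := by
  obtain ⟨M, hM, h⟩ := hB
  have hb : ∀ t : Icc (0 : ℝ) T, ‖f t‖ ≤ M * ∫ s in (0 : ℝ)..t, ‖f.IccExtend hT s‖ := by
    intro t
    rw [eq_neg_of_add_eq_zero_left (DFunLike.congr_fun hf t), norm_neg]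
    exact h f t
  have hz : ∀ t ∈ Icc 0 T, ∫ s in (0 : ℝ)..t, ‖f.IccExtend hT s‖ = 0 := by
    -- Grönwall for `Φ(t) = ∫_0^t ‖f‖`: `Φ' = ‖f‖ ≤ M Φ` and `Φ(0) = 0`.
    refine eq_zero_of_abs_deriv_le_mul_abs_self_of_eq_zero_right (K := M)
      (f' := fun t => ‖f.IccExtend hT t‖) ?_ ?_ (by simp) ?_
    · exact (intervalIntegral.continuous_primitive (fun a b =>
        (Continuous.intervalIntegrable (by fun_prop) _ _)) 0).continuousOn
    · intro t _
      have hc : Continuous fun t => ‖f.IccExtend hT t‖ := by fun_prop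
      exact (hc.integral_hasStrictDerivAt 0 t).hasDerivAt.hasDerivWithinAt
    · intro t ht
      have ht' : t ∈ Icc 0 T := ⟨ht.1, ht.2.le⟩
      rw [norm_norm, IccExtend_coe_of_mem hT f ht']
      exact (hb ⟨t, ht'⟩).trans (mul_le_mul_of_nonneg_left (le_abs_self _) hM)
  ext t
  have := hb t
  rw [hz t t.2, mul_zero] at this
  simpa using this

/-! ### Regularization through reversed polynomials in `J`. -/

/-- In a ring with a ring homomorphism `φ` whose values commute with `J`: if the coefficients `L`
and `P` of degrees `l ≤ N` and `N` have a product `Q` of degree at most `N`, the corresponding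
reversed polynomials in `J` compose to a left multiple of `J ^ l`. -/
theorem sum_mul_reversed_eq {S R : Type*} [Ring S] [Ring R] (φ : S →+* R) (J C : R)
    (hJ : ∀ a, Commute (φ a) J) (L P Q : ℕ → S) {l N : ℕ} (hl : l ≤ N)
    (hQ : ∀ q, (∑ m ∈ Finset.range (l + 1), ∑ r ∈ Finset.range (N + 1),
      if m + r = q then L m * P r else 0) = if q ≤ N then Q q else 0) :
    (∑ m ∈ Finset.range (l + 1), φ (L m) * J ^ (l - m)) *
        (∑ r ∈ Finset.range (N + 1), φ (P r) * J ^ (N - r) + J ^ N * C) =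
      J ^ l * (∑ q ∈ Finset.range (N + 1), φ (Q q) * J ^ (N - q) +
        ∑ m ∈ Finset.range (l + 1), φ (L m) * (J ^ (N - m) * C)) := by
  rw [mul_add, mul_add]
  congr 1
  · have h1 : J ^ l * ∑ q ∈ Finset.range (N + 1), φ (Q q) * J ^ (N - q) =
        ∑ q ∈ Finset.range (l + N + 1), φ (if q ≤ N then Q q else 0) * J ^ (l + N - q) := by
      rw [Finset.mul_sum, Finset.sum_subset_zero_on_sdiff (s₂ := Finset.range (l + N + 1))
        (g := fun q => φ (if q ≤ N then Q q else 0) * J ^ (l + N - q))]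
      · exact Finset.range_mono (by omega)
      · intro q hq
        rw [Finset.mem_sdiff, Finset.mem_range, Finset.mem_range] at hq
        rw [if_neg (by omega), map_zero, zero_mul]
      · intro q hq
        rw [Finset.mem_range] at hq
        rw [if_pos (by omega), ← mul_assoc, ← ((hJ (Q q)).pow_right l).eq, mul_assoc, ← pow_add]
        congr 2
        omega
    rw [h1, Finset.sum_mul_sum]
    simp_rw [← hQ, map_sum, Finset.sum_mul]
    rw [Finset.sum_comm (s := Finset.range (l + N + 1))]
    refine Finset.sum_congr rfl fun m hm => ?_
    rw [Finset.sum_comm]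
    refine Finset.sum_congr rfl fun r hr => ?_
    rw [Finset.mem_range] at hm hr
    rw [Finset.sum_eq_single (m + r)]
    · rw [if_pos rfl, map_mul, mul_assoc, ← mul_assoc (J ^ (l - m)),
        ← ((hJ (P r)).pow_right (l - m)).eq, mul_assoc, mul_assoc, ← pow_add]
      congr 3
      omega
    · intro q _ hq
      rw [if_neg (Ne.symm hq), map_zero, zero_mul]
    · intro h
      exact absurd (Finset.mem_range.2 (by omega)) h
  · rw [Finset.sum_mul, Finset.mul_sum]
    refine Finset.sum_congr rfl fun m hm => ?_
    rw [Finset.mem_range] at hm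
    -- `J^{l-m} J^N = J^l J^{N-m}` requires `m ≤ N`; this is where `l ≤ N` enters.
    rw [← mul_assoc (J ^ l), ← ((hJ (L m)).pow_right l).eq, mul_assoc, mul_assoc,
      ← mul_assoc, ← mul_assoc (J ^ l), ← mul_assoc, ← mul_assoc, ← pow_add, mul_assoc (φ _),
      ← pow_add]
    congr 3
    omega

/-- If the equation with reversed coefficients `P` and a Volterra bounded remainder has a left
regularization of order `l ≤ N`, it has only the trivial solution. -/
theorem eq_zero_of_reversed_eq_zero [CompleteSpace E] (hT₀ : 0 < T) (L P Q : ℕ → E →L[ℝ] E)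
    {l N : ℕ} (hl : l ≤ N)
    (hQ : ∀ q, (∑ m ∈ Finset.range (l + 1), ∑ r ∈ Finset.range (N + 1),
      if m + r = q then L m * P r else 0) = if q ≤ N then Q q else 0)
    (R : E →L[ℝ] E) (hR : R * Q N = 1) {C : Module.End ℝ C(Icc (0 : ℝ) T, E)}
    (hC : IsVolterraBounded hT₀.le C) {v : C(Icc (0 : ℝ) T, E)}
    (hv : (∑ r ∈ Finset.range (N + 1), pointwiseOp E T (P r) * volterraInt hT₀.le ^ (N - r) +
      volterraInt hT₀.le ^ N * C : Module.End ℝ C(Icc (0 : ℝ) T, E)) v = 0) : v = 0 := by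
  have h := sum_mul_reversed_eq (pointwiseOp E T) (volterraInt hT₀.le) C
    (commute_pointwiseOp_volterraInt hT₀.le) L P Q hl hQ
  have h0 := LinearMap.congr_fun h v
  rw [Module.End.mul_apply, hv, map_zero, Module.End.mul_apply, eq_comm] at h0
  have hinj : Function.Injective ⇑((volterraInt hT₀.le (E := E)) ^ l) := by
    rw [Module.End.coe_pow]
    exact (volterraInt_injective hT₀).iterate l
  have h1 := (map_eq_zero_iff _ hinj).1 h0
  -- The term `q = N` carries no power of `J` and is split off; every other term keeps a factor `J`
  -- or `C` and goes into `B`.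
  rw [Finset.sum_range_succ, Nat.sub_self, pow_zero, mul_one, add_right_comm,
    add_comm] at h1
  set B := ∑ q ∈ Finset.range N, pointwiseOp E T (Q q) * volterraInt hT₀.le ^ (N - q) +
    ∑ m ∈ Finset.range (l + 1), pointwiseOp E T (L m) * (volterraInt hT₀.le ^ (N - m) * C) with hBdef
  have hB : IsVolterraBounded hT₀.le B := by
    refine (IsVolterraBounded.sum _ fun q hq => ?_).add (IsVolterraBounded.sum _ fun m _ => ?_)
    · rw [Finset.mem_range] at hq
      obtain ⟨p, hp⟩ : ∃ p, N - q = p + 1 := ⟨N - q - 1, by omega⟩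
      rw [hp, pow_succ]
      exact ((isVolterraBounded_volterraInt _).volterraInt_pow_mul p).pointwiseOp_mul _
    · exact (hC.volterraInt_pow_mul _).pointwiseOp_mul _
  refine (hB.pointwiseOp_mul R).eq_zero ?_
  have h2 := congrArg (pointwiseOp E T R) h1
  rw [map_zero, LinearMap.add_apply, map_add, ← Module.End.mul_apply, ← Module.End.mul_apply,
    ← map_mul, hR, map_one] at h2
  exact h2

end VolterraOperators

/-! ### Coefficients of a regularized differential operator. -/

theorem iteratedDerivWithin_iteratedDerivWithin {F : Type*} [NormedAddCommGroup F]
    [NormedSpace ℝ F] (m r : ℕ) (f : ℝ → F) (s : Set ℝ) :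
    iteratedDerivWithin m (iteratedDerivWithin r f s) s = iteratedDerivWithin (m + r) f s := by
  induction m with
  | zero => simp
  | succ m ih => rw [iteratedDerivWithin_succ, ih, Nat.add_right_comm, ← iteratedDerivWithin_succ]

/-- The coefficients of the product of a left regularizing operator with a differential operator
vanish above the order of the latter, and the leading coefficient is invertible. -/
theorem IsLeftRegularizing.exists_coeff {n : ℕ} {T : ℝ} (hT : 0 < T) {N l : ℕ}
    {P L : ℕ → Matrix (Fin n) (Fin n) ℝ} (h : IsLeftRegularizing T N P (fun _ => 0) l L) :
    ∃ Q : ℕ → Matrix (Fin n) (Fin n) ℝ, (Q N).det ≠ 0 ∧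
      ∀ q, (∑ m ∈ Finset.range (l + 1), ∑ r ∈ Finset.range (N + 1),
        if m + r = q then L m * P r else 0) = if q ≤ N then Q q else 0 := by
  obtain ⟨A', K', -, -, hdet, heq⟩ := h
  have h0 : (0 : ℝ) ∈ Icc 0 T := ⟨le_rfl, hT.le⟩
  have hU : UniqueDiffOn ℝ (Icc 0 T) := uniqueDiffOn_Icc hT
  -- At `t = 0` the integral term vanishes, and among the derivatives of `t^q e` only the `q`-th
  -- survives. Testing there isolates the coefficient of order `q` on both sides, up to `q!`, even
  -- though `A'` may vary with `t`.
  refine ⟨fun q => A' q 0, hdet 0 h0, fun q => ?_⟩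
  apply Matrix.toLin'.injective
  refine LinearMap.ext fun e => ?_
  rw [Matrix.toLin'_apply, Matrix.toLin'_apply]
  set c : ℕ → ℝ → ℝ := fun i => iteratedDerivWithin i (fun t : ℝ => t ^ q) (Icc 0 T) with hc
  have hpow : ContDiff ℝ (⊤ : ℕ∞) (fun t : ℝ => t ^ q) := by fun_prop
  have hz : ∀ i, ∀ t ∈ Icc 0 T,
      iteratedDerivWithin i (fun t : ℝ => t ^ q • e) (Icc 0 T) t = c i t • e := fun i t ht =>
    iteratedDerivWithin_smul_const ht hU
      ((hpow.of_le (by exact_mod_cast le_top)).contDiffAt.contDiffWithinAt) e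
  have hcd : ∀ i (m : ℕ), ContDiffOn ℝ m (c i) (Icc 0 T) := by
    intro i m
    refine ContDiffOn.congr (f := iteratedDeriv i fun t : ℝ => t ^ q) ?_ fun t ht =>
      iteratedDerivWithin_eq_iteratedDeriv hU
        ((hpow.of_le (by exact_mod_cast le_top)).contDiffAt) ht
    exact (ContDiff.iterate_deriv' m i (hpow.of_le (by exact_mod_cast le_top))).contDiffOn |>.congr
      fun t _ => by rw [iteratedDeriv_eq_iterate]
  have hc0 : ∀ i, c i 0 = if i = q then (q.factorial : ℝ) else 0 := by
    intro i
    simp only [hc]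
    rw [iteratedDerivWithin_pow h0 hU]
    split_ifs with hi
    · subst hi; simp [Nat.descFactorial_self]
    · rcases lt_or_gt_of_ne hi with hi | hi
      · rw [zero_pow (by omega), mul_zero]
      · rw [Nat.descFactorial_eq_zero_iff_lt.2 hi]; simp
  have hop : EqOn (integroDiffOp T N (fun i _ => P i) (fun _ => 0) (fun t : ℝ => t ^ q • e))
      (fun t => ∑ r ∈ Finset.range (N + 1), c r t • (P r *ᵥ e)) (Icc 0 T) := by
    intro t ht
    simp [integroDiffOp, hz _ t ht, Matrix.mulVec_smul]
  have hder : ∀ m, iteratedDerivWithin m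
      (integroDiffOp T N (fun i _ => P i) (fun _ => 0) (fun t : ℝ => t ^ q • e)) (Icc 0 T) 0 =
      ∑ r ∈ Finset.range (N + 1), c (m + r) 0 • (P r *ᵥ e) := by
    intro m
    rw [iteratedDerivWithin_congr hop h0,
      iteratedDerivWithin_fun_sum (f := fun r t => c r t • (P r *ᵥ e)) h0 hU fun r _ =>
      ((hcd r m).contDiffWithinAt h0).smul contDiffWithinAt_const]
    refine Finset.sum_congr rfl fun r _ => ?_
    rw [iteratedDerivWithin_smul_const h0 hU ((hcd r m).contDiffWithinAt h0)]
    simp only [hc, iteratedDerivWithin_iteratedDerivWithin]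
  have key := heq (fun t : ℝ => t ^ q • e) (by fun_prop) 0 h0
  simp only [hder, integroDiffOp, hz _ 0 h0, hc0, intervalIntegral.integral_same, add_zero] at key
  have hq : (q.factorial : ℝ) ≠ 0 := by positivity
  apply smul_right_injective _ hq
  simp only [Matrix.sum_mulVec, Finset.smul_sum]
  have hr : (∑ i ∈ Finset.range (N + 1), A' i 0 *ᵥ ((if i = q then (q.factorial : ℝ) else 0) • e))
      = (q.factorial : ℝ) • ((if q ≤ N then A' q 0 else 0) *ᵥ e) := by
    split_ifs with hqN
    · rw [Finset.sum_eq_single q, if_pos rfl, Matrix.mulVec_smul]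
      · intro i _ hi; rw [if_neg hi, zero_smul, Matrix.mulVec_zero]
      · intro h; exact absurd (Finset.mem_range.2 (by omega)) h
    · rw [Matrix.zero_mulVec, smul_zero]
      refine Finset.sum_eq_zero fun i hi => ?_
      rw [Finset.mem_range] at hi
      rw [if_neg (by omega), zero_smul, Matrix.mulVec_zero]
  rw [hr] at key
  rw [← key]
  refine Finset.sum_congr rfl fun m _ => ?_
  rw [Matrix.mulVec_sum]
  refine Finset.sum_congr rfl fun r _ => ?_
  split_ifs
  · rw [Matrix.mulVec_smul, Matrix.mulVec_mulVec]
  · simp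

/-! ### From functions and matrix kernels on `[0, T]` to continuous maps. -/

/-- A function of class `C^k` on `[0, T]` and its derivatives, as continuous functions related by
the fundamental theorem of calculus. -/
theorem exists_continuousMap_iteratedDerivWithin {F : Type*} [NormedAddCommGroup F]
    [NormedSpace ℝ F] [CompleteSpace F] {T : ℝ} (hT : 0 < T) {k : ℕ} {f : ℝ → F}
    (hf : ContDiffOn ℝ k f (Icc 0 T)) :
    ∃ w : ℕ → C(Icc (0 : ℝ) T, F),
      (∀ i ≤ k, ∀ t : Icc (0 : ℝ) T, w i t = iteratedDerivWithin i f (Icc 0 T) t) ∧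
      ∀ i < k, ∀ t : Icc (0 : ℝ) T,
        w i t = iteratedDerivWithin i f (Icc 0 T) 0 + volterraInt hT.le (w (i + 1)) t := by
  have hU : UniqueDiffOn ℝ (Icc 0 T) := uniqueDiffOn_Icc hT
  have hc : ∀ i ≤ k, ContinuousOn (iteratedDerivWithin i f (Icc 0 T)) (Icc 0 T) := fun i hi =>
    hf.continuousOn_iteratedDerivWithin (by exact_mod_cast hi) hU
  refine ⟨fun i => if hi : i ≤ k then ⟨_, (hc i hi).domRestrict⟩ else 0, fun i hi t => ?_,
    fun i hi t => ?_⟩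
  · simp [dif_pos hi]
  · beta_reduce
    rw [dif_pos hi.le, volterraInt_apply]
    have hcont : ContinuousOn (iteratedDerivWithin i f (Icc 0 T)) (Icc 0 t) :=
      (hc i hi.le).mono (Icc_subset_Icc_right t.2.2)
    -- This form of the fundamental theorem needs derivatives only at interior points, where the
    -- derivative within `[0, T]` is the ordinary one.
    rw [intervalIntegral.integral_eq_sub_of_hasDeriv_right_of_le
      (f := iteratedDerivWithin i f (Icc 0 T)) t.2.1 hcont]
    · simp
    · intro x hx
      have hxT : x ∈ Ioo 0 T := ⟨hx.1, hx.2.trans_le t.2.2⟩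
      rw [IccExtend_coe_of_mem hT.le _ (Ioo_subset_Icc_self hxT), dif_pos (Nat.succ_le_of_lt hi)]
      have hd : DifferentiableWithinAt ℝ (iteratedDerivWithin i f (Icc 0 T)) (Icc 0 T) x :=
        hf.differentiableOn_iteratedDerivWithin (by exact_mod_cast hi) hU x
          (Ioo_subset_Icc_self hxT)
      have := (hd.hasDerivWithinAt.hasDerivAt (Icc_mem_nhds hxT.1 hxT.2)).hasDerivWithinAt
        (s := Ioi x)
      rw [← iteratedDerivWithin_succ] at this
      exact this
    · exact (ContinuousMap.continuous _).intervalIntegrable _ _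

/-- Square matrices as continuous linear operators. -/
noncomputable def matrixOp (n : ℕ) :
    Matrix (Fin n) (Fin n) ℝ →ₐ[ℝ] ((Fin n → ℝ) →L[ℝ] (Fin n → ℝ)) :=
  (Matrix.toLinAlgEquiv'.trans (Module.End.toContinuousLinearMap (Fin n → ℝ))).toAlgHom

theorem matrixOp_apply {n : ℕ} (M : Matrix (Fin n) (Fin n) ℝ) (x : Fin n → ℝ) :
    matrixOp n M x = M *ᵥ x := rfl

/-- Writing the kernel as scalar entries times fixed operators reduces its smoothness and
derivatives to the entrywise ones in `kernelDerivAtZero`. -/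
theorem matrixOp_eq_sum {n : ℕ} (M : Matrix (Fin n) (Fin n) ℝ) :
    matrixOp n M = ∑ p : Fin n × Fin n, M p.1 p.2 • matrixOp n (Matrix.single p.1 p.2 1) := by
  conv_lhs => rw [Matrix.matrix_eq_sum_single M]
  rw [Fintype.sum_prod_type, map_sum]
  refine Finset.sum_congr rfl fun a _ => ?_
  rw [map_sum]
  refine Finset.sum_congr rfl fun b _ => ?_
  rw [← map_smul, Matrix.smul_single, smul_eq_mul, mul_one]

section Kernel

variable {n : ℕ} {T : ℝ} {K : ℝ → Matrix (Fin n) (Fin n) ℝ}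

theorem contDiffOn_matrixOp (hT : 0 < T)
    (hK : ∀ a b, AnalyticOn ℝ (fun u => K u a b) (Icc 0 T)) (m : WithTop ℕ∞) :
    ContDiffOn ℝ m (fun u => matrixOp n (K u)) (Icc 0 T) := by
  simp_rw [matrixOp_eq_sum (K _)]
  exact ContDiffOn.sum fun p _ =>
    ((hK p.1 p.2).contDiffOn (uniqueDiffOn_Icc hT)).smul contDiffOn_const

theorem iteratedDerivWithin_matrixOp_zero (hT : 0 < T)
    (hK : ∀ a b, AnalyticOn ℝ (fun u => K u a b) (Icc 0 T)) (m : ℕ) :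
    iteratedDerivWithin m (fun u => matrixOp n (K u)) (Icc 0 T) 0 =
      matrixOp n (kernelDerivAtZero T K m) := by
  have h0 : (0 : ℝ) ∈ Icc 0 T := ⟨le_rfl, hT.le⟩
  have hU : UniqueDiffOn ℝ (Icc 0 T) := uniqueDiffOn_Icc hT
  have hd : ∀ a b, ContDiffWithinAt ℝ m (fun u => K u a b) (Icc 0 T) 0 := fun a b =>
    ((hK a b).contDiffOn hU).contDiffWithinAt h0
  rw [matrixOp_eq_sum (kernelDerivAtZero T K m)]
  simp_rw [matrixOp_eq_sum (K _)]
  rw [iteratedDerivWithin_fun_sum (f := fun (p : Fin n × Fin n) (u : ℝ) =>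
    K u p.1 p.2 • matrixOp n (Matrix.single p.1 p.2 1)) h0 hU
    fun p _ => (hd p.1 p.2).smul contDiffWithinAt_const]
  exact Finset.sum_congr rfl fun p _ => iteratedDerivWithin_smul_const h0 hU (hd p.1 p.2) _

theorem intervalIntegrable_conv (hT : 0 < T)
    (hK : ∀ a b, AnalyticOn ℝ (fun u => K u a b) (Icc 0 T)) {v : ℝ → Fin n → ℝ}
    (hv : ContinuousOn v (Icc 0 T)) {t : ℝ} (ht : t ∈ Icc 0 T) :
    IntervalIntegrable (fun s => K (t - s) *ᵥ v s) MeasureTheory.volume 0 t := by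
  refine ContinuousOn.intervalIntegrable ?_
  rw [uIcc_of_le ht.1]
  refine ContinuousOn.clm_apply (f := fun s => matrixOp n (K (t - s))) ?_
    (hv.mono (Icc_subset_Icc_right ht.2))
  exact (contDiffOn_matrixOp hT hK 0).continuousOn.comp (by fun_prop)
    fun s hs => ⟨by linarith [hs.2], by linarith [hs.1, ht.2]⟩

end Kernel

/-! ### Vanishing of solutions with zero jet. -/

/-- Taylor expansion of a convolution operator in powers of the Volterra integral. -/
theorem volterraConv_taylor {E : Type*} [NormedAddCommGroup E] [NormedSpace ℝ E]
    [CompleteSpace E] {T : ℝ} (hT : 0 ≤ T) {j : ℕ} (κ : ℕ → C(Icc (0 : ℝ) T, E →L[ℝ] E))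
    (κ₀ : ℕ → E →L[ℝ] E) (h : ∀ i < j, ∀ t, κ i t = κ₀ i + volterraInt hT (κ (i + 1)) t) :
    volterraConv hT (κ 0) =
      ∑ i ∈ Finset.range j, pointwiseOp E T (κ₀ i) * volterraInt hT ^ (i + 1) +
        volterraInt hT ^ j * volterraConv hT (κ j) := by
  induction j with
  | zero => simp
  | succ j ih =>
    rw [ih fun i hi => h i (by omega), volterraConv_eq hT (κ j) (κ (j + 1)) (κ₀ j)
      (h j (by omega)), Finset.sum_range_succ, mul_add, ← mul_assoc, ← mul_assoc, ← pow_succ,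
      ← ((commute_pointwiseOp_volterraInt hT (κ₀ j)).pow_right j).eq, mul_assoc, ← pow_succ,
      add_assoc]

/-- A solution whose derivatives of order less than `k` vanish at `0` is zero. -/
theorem IsHomSolution.eq_zero_of_jet_eq_zero {n : ℕ} {T : ℝ} (hT : 0 < T) {k : ℕ}
    {A : ℕ → Matrix (Fin n) (Fin n) ℝ} {K : ℝ → Matrix (Fin n) (Fin n) ℝ}
    (hK : ∀ a b, AnalyticOn ℝ (fun u => K u a b) (Icc 0 T)) {j l : ℕ}
    {L : ℕ → Matrix (Fin n) (Fin n) ℝ}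
    (hL : IsLeftRegularizing T (j + k) (prolongedCoeff T A K j) (fun _ => 0) l L)
    (hl : l ≤ j + k) {v : ℝ → Fin n → ℝ} (hv : IsHomSolution T k A K v)
    (hjet : ∀ i < k, iteratedDerivWithin i v (Icc 0 T) 0 = 0) : ∀ t ∈ Icc 0 T, v t = 0 := by
  obtain ⟨Q, hdet, hQ⟩ := hL.exists_coeff hT
  obtain ⟨w, hw, hwJ⟩ := exists_continuousMap_iteratedDerivWithin hT hv.1
  obtain ⟨κ, hκ, hκJ⟩ := exists_continuousMap_iteratedDerivWithin hT (contDiffOn_matrixOp hT hK j)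
  set op := pointwiseOp (Fin n → ℝ) T with hop
  set J := volterraInt hT.le (E := Fin n → ℝ) with hJ
  have hcomm : ∀ B, Commute (op B) J := commute_pointwiseOp_volterraInt hT.le
  -- The zero jet removes every constant of integration.
  have hw0 : ∀ i ≤ k, (J ^ i) (w i) = w 0 := by
    intro i
    induction i with
    | zero => intro _; rfl
    | succ i ih =>
      intro hi
      have e : w i = J (w (i + 1)) := ContinuousMap.ext fun t => by
        rw [hwJ i (by omega), hjet i (by omega), zero_add]
      rw [pow_succ, Module.End.mul_apply, ← e, ih (by omega)]
  have htaylor := volterraConv_taylor hT.le κ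
    (fun i => iteratedDerivWithin i (fun u => matrixOp n (K u)) (Icc 0 T) 0) hκJ
  simp only [iteratedDerivWithin_matrixOp_zero hT hK] at htaylor
  have heq : ∑ i ∈ Finset.range (k + 1), op (matrixOp n (A i)) (w i) +
      volterraConv hT.le (κ 0) (w 0) = 0 := by
    ext1 t
    have := hv.2 t t.2
    rw [ContinuousMap.add_apply, ContinuousMap.coe_sum, Finset.sum_apply,
      ContinuousMap.zero_apply, ← this]
    refine congrArg₂ (· + ·) (Finset.sum_congr rfl fun i hi => ?_) ?_
    · rw [pointwiseOp_apply, hw i (by rw [Finset.mem_range] at hi; omega)]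
      rfl
    · refine intervalIntegral.integral_congr fun s hs => ?_
      rw [uIcc_of_le t.2.1] at hs
      have hs1 : s ∈ Icc 0 T := ⟨hs.1, hs.2.trans t.2.2⟩
      have hs2 : (t : ℝ) - s ∈ Icc 0 T := ⟨by linarith [hs.2], by linarith [hs.1, t.2.2]⟩
      simp only [IccExtend_coe_of_mem hT.le _ hs1, IccExtend_coe_of_mem hT.le _ hs2,
        hw 0 (Nat.zero_le k), hκ 0 (Nat.zero_le j), iteratedDerivWithin_zero, matrixOp_apply]
  -- `J^k` applied to `heq`, with the Taylor expansion inserted. Indices `r = j + i` give `A_i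
  -- J^{k-i}`; indices `r < j` give the Taylor terms in reverse order, hence the reflection of the
  -- sum below.
  have hmain : (∑ r ∈ Finset.range (j + k + 1),
      op (matrixOp n (prolongedCoeff T A K j r)) * J ^ (j + k - r) +
        J ^ (j + k) * volterraConv hT.le (κ j) :
          Module.End ℝ C(Icc (0 : ℝ) T, Fin n → ℝ)) (w 0) = 0 := by
    have h1 := congrArg (J ^ k) heq
    rw [map_zero, map_add, map_sum, htaylor, ← Module.End.mul_apply, mul_add, Finset.mul_sum,
      ← mul_assoc, ← pow_add, LinearMap.add_apply, ← add_assoc, Nat.add_comm k j] at h1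
    rw [LinearMap.add_apply, ← h1]
    congr 1
    rw [add_assoc j k 1, Finset.sum_range_add, LinearMap.add_apply, add_comm]
    congr 1
    · rw [LinearMap.sum_apply]
      refine Finset.sum_congr rfl fun i hi => ?_
      rw [Finset.mem_range] at hi
      rw [← Module.End.mul_apply, ← ((hcomm _).pow_right k).eq, Module.End.mul_apply,
        Module.End.mul_apply, ← hw0 i (by omega),
        ← Module.End.mul_apply (J ^ (j + k - (j + i))) (J ^ i), ← pow_add]
      simp only [prolongedCoeff]
      rw [if_neg (by omega), Nat.add_sub_cancel_left, show j + k - (j + i) + i = k by omega]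
    · rw [← Finset.sum_range_reflect]
      congr 1
      refine Finset.sum_congr rfl fun i hi => ?_
      rw [Finset.mem_range] at hi
      rw [← mul_assoc, ← ((hcomm _).pow_right k).eq, mul_assoc, ← pow_add]
      simp only [prolongedCoeff]
      rw [if_pos (by omega), show j - 1 - (j - 1 - i) = i by omega,
        show j + k - (j - 1 - i) = k + (i + 1) by omega]
  have hw_zero : w 0 = 0 := by
    refine eq_zero_of_reversed_eq_zero hT (fun m => matrixOp n (L m)) _ (fun q => matrixOp n (Q q))
      hl (fun q => ?_) (matrixOp n (Q (j + k))⁻¹) ?_ (isVolterraBounded_volterraConv hT.le (κ j))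
      hmain
    · have := congrArg (matrixOp n) (hQ q)
      simp only [map_sum, apply_ite (matrixOp n), map_mul, map_zero] at this
      exact this
    · rw [← map_mul, Matrix.nonsing_inv_mul _ (isUnit_iff_ne_zero.2 hdet), map_one]
  intro t ht
  have := hw 0 (Nat.zero_le k) ⟨t, ht⟩
  rw [hw_zero, iteratedDerivWithin_zero] at this
  exact this.symm

/-! ### Linear structure of the solution set. -/

section SolutionSpace

variable {n : ℕ} {T : ℝ} {k : ℕ} {A : ℕ → Matrix (Fin n) (Fin n) ℝ}
  {K : ℝ → Matrix (Fin n) (Fin n) ℝ}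

theorem IsHomSolution.congr {v w : ℝ → Fin n → ℝ} (hv : IsHomSolution T k A K v)
    (h : EqOn w v (Icc 0 T)) : IsHomSolution T k A K w := by
  refine ⟨hv.1.congr h, fun t ht => ?_⟩
  rw [← hv.2 t ht]
  refine congrArg₂ (· + ·) (Finset.sum_congr rfl fun i _ => ?_) ?_
  · rw [iteratedDerivWithin_congr h ht]
  · refine intervalIntegral.integral_congr fun s hs => ?_
    rw [uIcc_of_le ht.1] at hs
    simp only [h ⟨hs.1, hs.2.trans ht.2⟩]

theorem iteratedDerivWithin_add_of_contDiffOn (hT : 0 < T) {v w : ℝ → Fin n → ℝ}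
    (hv : ContDiffOn ℝ k v (Icc 0 T)) (hw : ContDiffOn ℝ k w (Icc 0 T)) {i : ℕ} (hi : i ≤ k)
    {t : ℝ} (ht : t ∈ Icc 0 T) :
    iteratedDerivWithin i (v + w) (Icc 0 T) t =
      iteratedDerivWithin i v (Icc 0 T) t + iteratedDerivWithin i w (Icc 0 T) t :=
  have hi' : (i : WithTop ℕ∞) ≤ k := by exact_mod_cast hi
  iteratedDerivWithin_add ht (uniqueDiffOn_Icc hT) ((hv t ht).of_le hi') ((hw t ht).of_le hi')

theorem IsHomSolution.add (hT : 0 < T) (hK : ∀ a b, AnalyticOn ℝ (fun u => K u a b) (Icc 0 T))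
    {v w : ℝ → Fin n → ℝ} (hv : IsHomSolution T k A K v) (hw : IsHomSolution T k A K w) :
    IsHomSolution T k A K (v + w) := by
  refine ⟨hv.1.add hw.1, fun t ht => ?_⟩
  have : integroDiffOp T k (fun i _ => A i) K (v + w) t =
      integroDiffOp T k (fun i _ => A i) K v t + integroDiffOp T k (fun i _ => A i) K w t := by
    simp only [integroDiffOp, Pi.add_apply, Matrix.mulVec_add]
    rw [intervalIntegral.integral_add (intervalIntegrable_conv hT hK hv.1.continuousOn ht)
      (intervalIntegrable_conv hT hK hw.1.continuousOn ht), add_add_add_comm,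
      ← Finset.sum_add_distrib]
    congr 1
    refine Finset.sum_congr rfl fun i hi => ?_
    rw [Finset.mem_range] at hi
    rw [iteratedDerivWithin_add_of_contDiffOn hT hv.1 hw.1 (by omega) ht, Matrix.mulVec_add]
  rw [this, hv.2 t ht, hw.2 t ht, add_zero]

theorem IsHomSolution.smul {v : ℝ → Fin n → ℝ} (hv : IsHomSolution T k A K v) (c : ℝ) :
    IsHomSolution T k A K (c • v) := by
  refine ⟨hv.1.const_smul c, fun t ht => ?_⟩
  have : integroDiffOp T k (fun i _ => A i) K (c • v) t =
      c • integroDiffOp T k (fun i _ => A i) K v t := by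
    simp only [integroDiffOp, iteratedDerivWithin_const_smul_field, Pi.smul_apply,
      Matrix.mulVec_smul, intervalIntegral.integral_smul, smul_add, Finset.smul_sum]
  rw [this, hv.2 t ht, smul_zero]

theorem isHomSolution_zero : IsHomSolution T k A K 0 := by
  refine ⟨contDiffOn_const, fun t _ => ?_⟩
  have h : ∀ i, iteratedDerivWithin i (0 : ℝ → Fin n → ℝ) (Icc 0 T) t = 0 := fun i => by
    simp
  simp [integroDiffOp, h]

/-- The solutions, extended by zero outside `[0, T]`, form a vector space. -/
def homSolutionSubmodule (k : ℕ) (A : ℕ → Matrix (Fin n) (Fin n) ℝ) (hT : 0 < T)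
    (hK : ∀ a b, AnalyticOn ℝ (fun u => K u a b) (Icc 0 T)) : Submodule ℝ (ℝ → Fin n → ℝ) where
  carrier := {v | IsHomSolution T k A K v ∧ ∀ t ∉ Icc 0 T, v t = 0}
  add_mem' hv hw := ⟨hv.1.add hT hK hw.1, fun t ht => by simp [hv.2 t ht, hw.2 t ht]⟩
  zero_mem' := ⟨isHomSolution_zero, fun _ _ => rfl⟩
  smul_mem' c _ hv := ⟨hv.1.smul c, fun t ht => by simp [hv.2 t ht]⟩

/-- The initial values `v^{(i)}(0)`, `i < k`, of a solution. -/
noncomputable def homSolutionJet (k : ℕ) (A : ℕ → Matrix (Fin n) (Fin n) ℝ) (hT : 0 < T)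
    (hK : ∀ a b, AnalyticOn ℝ (fun u => K u a b) (Icc 0 T)) :
    homSolutionSubmodule k A hT hK →ₗ[ℝ] (Fin k → Fin n → ℝ) where
  toFun v := fun i : Fin k => iteratedDerivWithin i (v : ℝ → Fin n → ℝ) (Icc 0 T) 0
  map_add' v w := funext fun i =>
    iteratedDerivWithin_add_of_contDiffOn hT v.2.1.1 w.2.1.1 i.2.le ⟨le_rfl, hT.le⟩
  map_smul' c _ := funext fun _ => iteratedDerivWithin_const_smul_field c _

theorem finiteDimSolutionSpace_of_finite (hT : 0 < T)
    (hK : ∀ a b, AnalyticOn ℝ (fun u => K u a b) (Icc 0 T))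
    [Module.Finite ℝ (homSolutionSubmodule k A hT hK)] : FiniteDimSolutionSpace T k A K := by
  set b := Module.finBasis ℝ (homSolutionSubmodule k A hT hK) with hb
  set X : ℝ → Matrix (Fin n) (Fin (Module.finrank ℝ (homSolutionSubmodule k A hT hK))) ℝ :=
    fun t => Matrix.of fun a i => (b i : ℝ → Fin n → ℝ) t a with hX
  have hXc : ∀ c t, X t *ᵥ c =
      ((∑ i, c i • b i : homSolutionSubmodule k A hT hK) : ℝ → Fin n → ℝ) t := by
    intro c t
    ext a
    simp [hX, Matrix.mulVec, dotProduct, mul_comm]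
  refine ⟨_, X, fun a i => contDiffOn_pi.1 (b i).2.1.1 a, fun v => ⟨fun hv => ?_, ?_⟩⟩
  -- The equation sees `v` only on `[0, T]`, so `v` may be replaced by its extension by zero, the
  -- representative lying in the submodule.
  · have hmem : (Icc 0 T).indicator v ∈ homSolutionSubmodule k A hT hK :=
      ⟨hv.congr fun t ht => indicator_of_mem ht v, fun t ht => indicator_of_notMem ht v⟩
    refine ⟨b.repr ⟨_, hmem⟩, fun t ht => ?_⟩
    rw [hXc, b.sum_repr]
    exact (indicator_of_mem ht v).symm
  · rintro ⟨c, hc⟩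
    exact (∑ i, c i • b i : homSolutionSubmodule k A hT hK).2.1.congr fun t ht => by
      rw [hc t ht, hXc]

end SolutionSpace

theorem theorem3 {n : ℕ} (T : ℝ) (hT : 0 < T) (k : ℕ) (hk : 1 ≤ k)
    (A : ℕ → Matrix (Fin n) (Fin n) ℝ) (hA : (A k).det = 0)
    (K : ℝ → Matrix (Fin n) (Fin n) ℝ)
    (hK : ∀ a b, AnalyticOn ℝ (fun u => K u a b) (Icc 0 T))
    (hidx : ∃ j l : ℕ,
      HasIndex T (j + k) (prolongedCoeff T A K j) (fun _ => 0) l ∧ l ≤ j + k) :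
    FiniteDimSolutionSpace T k A K := by
  obtain ⟨j, l, ⟨⟨L, hL⟩, -⟩, hl⟩ := hidx
  -- On `[0, T]` this is the vanishing of solutions with zero jet; elsewhere it is the convention of
  -- extension by zero.
  have hinj : Function.Injective (homSolutionJet k A hT hK) := by
    rw [injective_iff_map_eq_zero]
    intro v hv
    ext1
    funext t
    by_cases ht : t ∈ Icc 0 T
    · exact v.2.1.eq_zero_of_jet_eq_zero hT hK hL hl (fun i hi => congrFun hv ⟨i, hi⟩) t ht
    · exact v.2.2 t ht
  have := Module.Finite.of_injective _ hinj
  exact finiteDimSolutionSpace_of_finite hT hK
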